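/- Let $n,k$ be the numbers of arms and of contexts. Let $A\in\mathbb{R}^{k\times n}$ be a known context probability matrix, whose columns $A_1,\dots,A_n$ are probability vectors on $[k]$, and let $\mu\in\mathbb{R}^k$. In every round $t\ge 1$ a learner pulls an arm $i_t\in[n]$ and observes a context $z_t\in[k]$ with $\Pr(z_t=j\mid i_t=i)=A_{j,i}$ and a reward $y_t$ which, given $z_t=j$, is Gaussian with mean $\mu_j$ and unit variance, independently of the arm and of the past (separator context). The arm $i_t$ is chosen by a sampling rule, deterministic or randomized, from the history of the rounds $1,\dots,t-1$. Let $\mathcal I(A)$ be the set of all $\mu\in\mathbb{R}^k$ for which the maximizer $i^*(\mu)$ of $i\mapsto A_i^\top\mu$ is unique, and let $\mathrm{Alt}(\mu,A)=\{\mu'\in\mathcal I(A): i^*(\mu')\neq i^*(\mu)\}$. After $t$ rounds let $N^Z_j(t)$ be the number of rounds in which context $j$ was observed and let $\hat\mu_j(t)$ be the average of the rewards observed in these rounds. Define the GLR statistic $$\hat\Lambda(t)=\inf_{\mu'\in\mathrm{Alt}(\hat\mu(t),A)}\ \sum_{j\in[k]}N^Z_j(t)\,\frac{(\hat\mu_j(t)-\mu'_j)^2}{2}$$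 if $\hat\mu(t)\in\mathcal I(A)$ (with $\inf\emptyset=+\infty$), and $\hat\Lambda(t)=0$ otherwise. For $\delta\in(0,1)$ define the threshold $$\hat c_t(\delta)=2\sum_{j\in[k]}\ln\bigl(4+\ln N^Z_j(t)\bigr)+k\,C^g\!\left(\frac{\ln(1/\delta)}{k}\right),$$ where $$C^g(x)=\min_{\lambda\in(\frac12,1]}\frac{g(\lambda)+x}{\lambda},\qquad g(\lambda)=2\lambda-2\lambda\ln(4\lambda)+\ln\zeta(2\lambda)-\tfrac12\ln(1-\lambda),\qquad \zeta(s)=\sum_{m\ge1}m^{-s}$$ (so that $g(1)=+\infty$). The GLR stopping rule is $$\tau_\delta=\inf\{t\in\mathbb N:\ N^Z_j(t)\ge 1 \text{ for all } j\in[k]\ \text{ and }\ \hat\Lambda(t)>\hat c_t(\delta)\},$$ and at time $\tau_\delta$ the arm $\hat\imath_\tau=i^*(\hat\mu(\tau_\delta))$ is recommended. Then, for every $\delta\in(0,1)$, every sampling rule (which may depend on $A$) combined with this stopping rule and recommendation is $\delta$-correct: for every context probability matrix $A$ and every $\mu\in\mathcal I(A)$, $$\Pr_{\mu,A}\bigl(\tau_\delta<\infty,\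 \hat\imath_\tau\neq i^*(\mu)\bigr)\le\delta .$$ -/

import Mathlib

open MeasureTheory ProbabilityTheory

noncomputable section

namespace PostActionBAI

/-! ### Bandit instances with a separator context -/

/-- A context probability matrix with `n` arms and `k` contexts: `A j i` is the probability of
context `j` when arm `i` is pulled, so every column is a probability vector. -/
structure ContextMatrix (n k : ℕ) where
  /-- the underlying `k × n` matrix -/
  mat : Matrix (Fin k) (Fin n) ℝ
  nonneg : ∀ j i, 0 ≤ mat j i
  sum_col : ∀ i, ∑ j, mat j i = 1

variable {n k : ℕ}

/-- What is observed in one round: the pulled arm, the context and the reward. -/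
abbrev Obs (n k : ℕ) : Type := Fin n × Fin k × ℝ

/-- A history of `t` rounds. -/
abbrev Hist (n k t : ℕ) : Type := Fin t → Obs n k

/-- The joint law of context and reward when arm `i` is pulled: the context has law `A_i`, and given
that it equals `j` the reward is Gaussian with mean `μ j` and unit variance, whatever `i` is. -/
def armLaw (A : ContextMatrix n k) (μ : Fin k → ℝ) (i : Fin n) : Measure (Fin k × ℝ) :=
  ∑ j, ENNReal.ofReal (A.mat j i) • (Measure.dirac j).prod (gaussianReal (μ j) 1)

instance armLaw_isProbabilityMeasure (A : ContextMatrix n k) (μ : Fin k → ℝ) (i : Fin n) :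
    IsProbabilityMeasure (armLaw A μ i) := by
  constructor
  simp only [armLaw, Measure.finsetSum_apply, Measure.smul_apply, measure_univ, smul_eq_mul,
    mul_one]
  rw [← ENNReal.ofReal_sum_of_nonneg (fun j _ => A.nonneg j i), A.sum_col i, ENNReal.ofReal_one]

/-- The environment, as a kernel from arms to pairs (context, reward). -/
def envKernel (A : ContextMatrix n k) (μ : Fin k → ℝ) : Kernel (Fin n) (Fin k × ℝ) :=
  Kernel.ofFunOfCountable (armLaw A μ)

instance envKernel_isMarkovKernel (A : ContextMatrix n k) (μ : Fin k → ℝ) :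
    IsMarkovKernel (envKernel A μ) :=
  ⟨fun i => armLaw_isProbabilityMeasure A μ i⟩

/-- The mean reward `A_i ⬝ μ` of arm `i`. -/
def armMean (A : ContextMatrix n k) (μ : Fin k → ℝ) (i : Fin n) : ℝ :=
  ∑ j, A.mat j i * μ j

/-- Arm `i` is the unique arm of largest mean reward. -/
def IsUniqueBest (A : ContextMatrix n k) (μ : Fin k → ℝ) (i : Fin n) : Prop :=
  ∀ l, l ≠ i → armMean A μ l < armMean A μ i

/-- The set `I(A)` of mean vectors for which there is a unique best arm. -/
def uniqueBestSet (A : ContextMatrix n k) : Set (Fin k → ℝ) :=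
  {μ | ∃ i, IsUniqueBest A μ i}

open Classical in
/-- The unique best arm `i*(μ)`, and `none` if there is no unique best arm. -/
def bestArm (A : ContextMatrix n k) (μ : Fin k → ℝ) : Option (Fin n) :=
  if h : ∃ i, IsUniqueBest A μ i then some h.choose else none

/-- `Alt(μ, A)`: the mean vectors with a unique best arm that is not the one of `μ`. -/
def Alt (A : ContextMatrix n k) (μ : Fin k → ℝ) : Set (Fin k → ℝ) :=
  {μ' | μ' ∈ uniqueBestSet A ∧ bestArm A μ' ≠ bestArm A μ}

/-! ### Algorithms and their interaction with an instance -/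

/-- A (possibly randomized) sampling rule: after `t` rounds with history `h`, the arm of the next
round is drawn from the probability measure `kernel t h`. -/
structure SamplingRule (n k : ℕ) where
  /-- the law of the next arm given the history -/
  kernel : (t : ℕ) → Kernel (Hist n k t) (Fin n)
  markov : ∀ t, IsMarkovKernel (kernel t)

/-- An algorithm: a sampling rule, a stopping rule and a decision rule, all based on the history. -/
structure Algorithm (n k : ℕ) where
  /-- the sampling rule -/
  sampling : SamplingRule n k
  /-- `stops h`: the stopping criterion holds for the history `h` -/
  stops : {t : ℕ} → Hist n k t → Prop
  /-- the arm recommended after the history `h` (`none` means that no arm is named) -/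
  decision : {t : ℕ} → Hist n k t → Option (Fin n)

/-- The law of the observation of a round given the history before it: draw the arm from the
sampling rule, then context and reward from the environment. -/
def roundKernel (S : SamplingRule n k) (A : ContextMatrix n k) (μ : Fin k → ℝ) (t : ℕ) :
    Kernel (Hist n k t) (Obs n k) :=
  (S.kernel t).compProd (Kernel.prodMkLeft (Hist n k t) (envKernel A μ))

instance roundKernel_isMarkovKernel (S : SamplingRule n k) (A : ContextMatrix n k) (μ : Fin k → ℝ)
    (t : ℕ) : IsMarkovKernel (roundKernel S A μ t) := by
  have := S.markov t
  unfold roundKernel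
  infer_instance

/-- Observations at the times `0, …, t`, seen as a history of `t + 1` rounds. -/
def toHist (t : ℕ) (x : (s : Finset.Iic t) → Obs n k) : Hist n k (t + 1) :=
  fun s => x ⟨s, Finset.mem_Iic.mpr (Nat.lt_succ_iff.mp s.isLt)⟩

lemma measurable_toHist (t : ℕ) : Measurable (toHist (n := n) (k := k) t) :=
  measurable_pi_lambda _ fun _ => measurable_pi_apply _

/-- The law of the infinite sequence of observations when sampling rule `S` runs on the instance
`(A, μ)`; the observation of the first round has index `0`. -/
def law (S : SamplingRule n k) (A : ContextMatrix n k) (μ : Fin k → ℝ) : Measure (ℕ → Obs n k) :=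
  Kernel.trajMeasure (X := fun _ => Obs n k) (roundKernel S A μ 0 Fin.elim0)
    (fun t => (roundKernel S A μ (t + 1)).comap (toHist t) (measurable_toHist t))

/-- The history of the first `t` rounds of a trajectory. -/
def histUpTo (ω : ℕ → Obs n k) (t : ℕ) : Hist n k t := fun s => ω s

/-- The stopping time: the first `t` at which the criterion holds, `⊤` if there is none. -/
def Algorithm.stoppingTime (alg : Algorithm n k) (ω : ℕ → Obs n k) : ℕ∞ :=
  ⨅ (t : ℕ) (_ : alg.stops (histUpTo ω t)), (t : ℕ∞)

/-- The arm recommended at the stopping time (only meaningful when the stopping time is finite). -/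
def Algorithm.recommendation (alg : Algorithm n k) (ω : ℕ → Obs n k) : Option (Fin n) :=
  alg.decision (histUpTo ω (alg.stoppingTime ω).toNat)

/-- `δ`-correctness in the separator setting. The context matrix is known to the learner, so the
algorithm may depend on it. -/
def IsDeltaCorrect (δ : ℝ) (alg : ContextMatrix n k → Algorithm n k) : Prop :=
  ∀ (A : ContextMatrix n k) (μ : Fin k → ℝ), μ ∈ uniqueBestSet A →
    law (alg A).sampling A μ
      {ω | (alg A).stoppingTime ω < ⊤ ∧ (alg A).recommendation ω ≠ bestArm A μ}
      ≤ ENNReal.ofReal δ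

/-! ### The generalized likelihood ratio stopping rule -/

/-- `N_j(t)`: the number of rounds of the history in which context `j` was observed. -/
def contextCount {t : ℕ} (h : Hist n k t) (j : Fin k) : ℕ :=
  (Finset.univ.filter fun s => (h s).2.1 = j).card

/-- The empirical mean of the rewards observed together with context `j`. -/
def empMean {t : ℕ} (h : Hist n k t) (j : Fin k) : ℝ :=
  (∑ s ∈ Finset.univ.filter (fun s => (h s).2.1 = j), (h s).2.2) / contextCount h j

open Classical in
/-- The GLR statistic (an infimum over the empty set is `⊤`). -/
def glrStatistic (A : ContextMatrix n k) {t : ℕ} (h : Hist n k t) : EReal :=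
  if empMean h ∈ uniqueBestSet A then
    ⨅ μ' ∈ Alt A (empMean h),
      ((∑ j, (contextCount h j : ℝ) * ((empMean h j - μ' j) ^ 2 / 2) : ℝ) : EReal)
  else 0

/-- `g(x) = 2x - 2x ln(4x) + ln ζ(2x) - (1/2) ln(1 - x)` for `1/2 < x < 1`, with
`ζ(s) = ∑_{m ≥ 1} m ^ (-s)`. -/
def gFun (x : ℝ) : ℝ :=
  2 * x - 2 * x * Real.log (4 * x) + Real.log (∑' m : ℕ, ((m : ℝ) + 1) ^ (-(2 * x)))
    - 1 / 2 * Real.log (1 - x)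

/-- `C^g(x)`, the minimum of `(g(l) + x) / l` over `l ∈ (1/2, 1]`. At `l = 1` the term
`-(1/2) ln(1 - l)` is `+∞`, so this endpoint does not contribute; it has to be left out here because
`Real.log 0 = 0`. -/
def Cg (x : ℝ) : ℝ := sInf ((fun l => (gFun l + x) / l) '' Set.Ioo (1 / 2) 1)

/-- The threshold `2 ∑_j ln(4 + ln N_j(t)) + k C^g(ln(1/δ) / k)`. -/
def threshold (δ : ℝ) {t : ℕ} (h : Hist n k t) : ℝ :=
  2 * ∑ j : Fin k, Real.log (4 + Real.log (contextCount h j)) + k * Cg (Real.log (1 / δ) / k)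

/-- The algorithm with sampling rule `S` that stops as soon as the GLR statistic exceeds the
threshold and then recommends the empirically best arm. Empirical means and threshold are only
defined once every context has been observed, so that the criterion is tested from then on. -/
def glrAlgorithm (δ : ℝ) (S : SamplingRule n k) (A : ContextMatrix n k) : Algorithm n k where
  sampling := S
  stops := fun h => (∀ j, 0 < contextCount h j) ∧ (threshold δ h : EReal) < glrStatistic A h
  decision := fun h => bestArm A (empMean h)

end PostActionBAI

end

/-! If the recommendation is wrong, the true `μ` competes in the infimum defining the GLR statistic,
so the statistic is at most `∑ j, N_j (μ̂_j - μ_j)² / 2` (`glrStatistic_le`). An error therefore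
forces this deviation above the threshold at some time, and it suffices to bound the probability of
that event over all times at once.

This is the method of mixtures. For a fixed shift `η` of the means, the likelihood ratio is a
martingale of mean 1 under every sampling rule, because the reward law given the context does not
depend on the arm. Averaging over a product prior on `η` preserves this, and Ville's inequality
bounds the probability of ever reaching `1 / δ` by `δ` (`mul_law_mixtureRatio_le`).

Conversely, the mixture is large whenever the deviation is (`le_mixtureRatio`). It factorises over
contexts, and in each factor the prior has a Gaussian component at the scale of `N_j`, whose weight
costs only the iterated logarithm in the threshold; the constants add up to `gFun l`
(`exp_le_component`). Taking the infimum over `l` produces `Cg`. -/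

noncomputable section

namespace PostActionBAI

variable {n k : ℕ}

/-! ### The Gaussian mixture prior -/

/-- The weight normalisation `ζ(2l) = ∑_{m ≥ 1} m ^ (-2l)`. -/
def zetaSum (l : ℝ) : ℝ := ∑' m : ℕ, ((m : ℝ) + 1) ^ (-(2 * l))

lemma summable_zetaSum {l : ℝ} (hl : 1 / 2 < l) :
    Summable fun m : ℕ => ((m : ℝ) + 1) ^ (-(2 * l)) := by
  have h : Summable fun m : ℕ => (m : ℝ) ^ (-(2 * l)) := Real.summable_nat_rpow.mpr (by linarith)
  simpa using (summable_nat_add_iff 1).mpr h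

lemma one_le_zetaSum {l : ℝ} (hl : 1 / 2 < l) : 1 ≤ zetaSum l := by
  have h := (summable_zetaSum hl).le_tsum 0 fun m _ => by positivity
  simpa [zetaSum] using h

/-- The precision of the `m`-th Gaussian component of the prior. -/
def precision (l : ℝ) (m : ℕ) : ℝ := Real.exp (4 * l * m) * (1 - l) / l

lemma precision_pos {l : ℝ} (hl : 1 / 2 < l) (hl' : l < 1) (m : ℕ) : 0 < precision l m := by
  have h1 : 0 < 1 - l := by linarith
  have h2 : 0 < l := by linarith
  unfold precision
  positivity

/-- The prior over natural-parameter shifts: a countable mixture of centred Gaussians whose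
precisions form a geometric sequence. -/
def prior (l : ℝ) : Measure ℝ :=
  Measure.sum fun m : ℕ => ENNReal.ofReal (((m : ℝ) + 1) ^ (-(2 * l)) / zetaSum l) •
    gaussianReal 0 (Real.toNNReal (precision l m)⁻¹)

lemma isProbabilityMeasure_prior {l : ℝ} (hl : 1 / 2 < l) : IsProbabilityMeasure (prior l) := by
  constructor
  have hz : 0 < zetaSum l := lt_of_lt_of_le one_pos (one_le_zetaSum hl)
  simp only [prior, Measure.sum_apply _ MeasurableSet.univ, Measure.smul_apply, measure_univ,
    smul_eq_mul, mul_one]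
  rw [← ENNReal.ofReal_tsum_of_nonneg (fun m => by positivity) ((summable_zetaSum hl).div_const _),
    tsum_div_const]
  change ENNReal.ofReal (zetaSum l / zetaSum l) = 1
  rw [div_self hz.ne', ENNReal.ofReal_one]

/-- Completing the square: the integrand times the prior density is a constant multiple of the
density of a Gaussian with mean `S / (c + N)` and precision `c + N`. -/
lemma lintegral_exp_gaussianReal {c : ℝ} (hc : 0 < c) {N : ℝ} (hN : 0 ≤ N) (S : ℝ) :
    ∫⁻ x, ENNReal.ofReal (Real.exp (x * S - N * x ^ 2 / 2))
        ∂(gaussianReal 0 (Real.toNNReal c⁻¹)) =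
      ENNReal.ofReal (Real.sqrt (c / (c + N)) * Real.exp (S ^ 2 / (2 * (N + c)))) := by
  have hv : Real.toNNReal c⁻¹ ≠ 0 := by simpa using hc
  have hcN : 0 < c + N := by linarith
  have hv' : Real.toNNReal (c + N)⁻¹ ≠ 0 := by simpa using hcN
  rw [gaussianReal_of_var_ne_zero _ hv,
    lintegral_withDensity_eq_lintegral_mul _ (measurable_gaussianPDF _ _) (by fun_prop)]
  have key : ∀ x, (gaussianPDF 0 (Real.toNNReal c⁻¹) *
      fun x => ENNReal.ofReal (Real.exp (x * S - N * x ^ 2 / 2))) x =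
      ENNReal.ofReal (Real.sqrt (c / (c + N)) * Real.exp (S ^ 2 / (2 * (N + c)))) *
        gaussianPDF (S / (c + N)) (Real.toNNReal (c + N)⁻¹) x := by
    intro x
    simp only [Pi.mul_apply, gaussianPDF]
    rw [← ENNReal.ofReal_mul (gaussianPDFReal_nonneg _ _ _), ← ENNReal.ofReal_mul (by positivity)]
    congr 1
    simp only [gaussianPDFReal, Real.coe_toNNReal _ (inv_nonneg.mpr hc.le),
      Real.coe_toNNReal _ (inv_nonneg.mpr hcN.le)]
    have h1 : (Real.sqrt (2 * Real.pi * c⁻¹))⁻¹ =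
        Real.sqrt (c / (c + N)) * (Real.sqrt (2 * Real.pi * (c + N)⁻¹))⁻¹ := by
      rw [← Real.sqrt_inv, ← Real.sqrt_inv, ← Real.sqrt_mul (by positivity)]
      congr 1
      field_simp
    rw [h1, mul_assoc, ← Real.exp_add, mul_mul_mul_comm, ← Real.exp_add]
    congr 2
    field_simp
    ring
  simp_rw [key]
  rw [lintegral_const_mul _ (measurable_gaussianPDF _ _), lintegral_gaussianPDF_eq_one _ hv',
    mul_one]

/-- The component of the prior on the scale of `N` dominates the deviation functional. -/
lemma exp_le_component {l : ℝ} (hl : 1 / 2 < l) (hl' : l < 1) {N : ℝ} (hN : 1 ≤ N) (S : ℝ) :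
    ∃ m : ℕ, Real.exp (l * (S ^ 2 / (2 * N) - 2 * Real.log (4 + Real.log N)) - gFun l) ≤
      ((m : ℝ) + 1) ^ (-(2 * l)) / zetaSum l *
        (Real.sqrt (precision l m / (precision l m + N)) *
          Real.exp (S ^ 2 / (2 * (N + precision l m)))) := by
  have h0 : 0 < l := by linarith
  have h1 : 0 < 1 - l := by linarith
  have hN0 : 0 < N := by linarith
  have hL : 0 ≤ Real.log N := Real.log_nonneg hN
  have hz : 0 < zetaSum l := lt_of_lt_of_le one_pos (one_le_zetaSum hl)
  -- With this `m`, `a = exp (4 l m)` satisfies `a ≤ N ≤ a * exp (4 l)`: the grid of precisions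
  -- meets the scale of `N` up to a constant factor.
  refine ⟨⌊Real.log N / (4 * l)⌋₊, ?_⟩
  set m := ⌊Real.log N / (4 * l)⌋₊ with hm
  set c := precision l m with hcdef
  have hc : 0 < c := precision_pos hl hl' m
  have hm1 : (m : ℝ) ≤ Real.log N / (4 * l) := Nat.floor_le (by positivity)
  have hm2 : Real.log N / (4 * l) < m + 1 := Nat.lt_floor_add_one _
  rw [le_div_iff₀ (by positivity)] at hm1
  rw [div_lt_iff₀ (by positivity)] at hm2
  set a := Real.exp (4 * l * m) with ha
  have ha0 : 0 < a := Real.exp_pos _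
  have haN : a ≤ N := by
    rw [ha, ← Real.le_log_iff_exp_le hN0]; linarith
  have hNa : N ≤ a * Real.exp (4 * l) := by
    rw [ha, ← Real.exp_add, ← Real.log_le_iff_le_exp hN0]; linarith
  have hlc : l * c = a * (1 - l) := by
    rw [hcdef, precision, ← ha]; field_simp
  have hpow : ((m : ℝ) + 1) ^ (-(2 * l)) =
      Real.exp (-(2 * l) * Real.log ((m : ℝ) + 1)) := by
    rw [Real.rpow_def_of_pos (by positivity), mul_comm]
  -- The bound `4 * l * (m + 1) ≤ 4 + log N` uses `l < 1`; this is the origin of the 4 in the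
  -- threshold.
  have hlogm : Real.log ((m : ℝ) + 1) ≤ Real.log (4 + Real.log N) - Real.log (4 * l) := by
    rw [← Real.log_div (by positivity) (by positivity)]
    apply Real.log_le_log (by positivity)
    rw [le_div_iff₀ (by positivity)]
    nlinarith
  have hsq : Real.exp (1 / 2 * Real.log (1 - l) - 2 * l) ≤ Real.sqrt (c / (c + N)) := by
    apply Real.le_sqrt_of_sq_le
    rw [← Real.exp_nat_mul]
    have : ((2 : ℕ) : ℝ) * (1 / 2 * Real.log (1 - l) - 2 * l) = Real.log (1 - l) - 4 * l := by
      push_cast; ring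
    rw [this, Real.exp_sub, Real.exp_log h1, div_le_div_iff₀ (Real.exp_pos _) (by positivity)]
    have he : 1 ≤ Real.exp (4 * l) := Real.one_le_exp (by positivity)
    have : l * (c + N) ≤ l * c * Real.exp (4 * l) / (1 - l) := by
      rw [hlc, mul_add, hlc]
      have : a * (1 - l) * Real.exp (4 * l) / (1 - l) = a * Real.exp (4 * l) := by field_simp
      rw [this]
      nlinarith [mul_le_mul_of_nonneg_left he ha0.le]
    rw [le_div_iff₀ h1] at this
    nlinarith
  -- The factor `(1 - l) / l` in the precision is tuned for this: `l * c = a * (1 - l) ≤ N * (1 -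
  -- l)`, so `l * (N + c) ≤ N`.
  have hS : l * (S ^ 2 / (2 * N)) ≤ S ^ 2 / (2 * (N + c)) := by
    rw [mul_div_assoc', div_le_div_iff₀ (by positivity) (by positivity)]
    have h3 : l * (N + c) ≤ N := by rw [mul_add, hlc]; nlinarith
    nlinarith [mul_le_mul_of_nonneg_left h3 (sq_nonneg S)]
  have hg : gFun l = 2 * l - 2 * l * Real.log (4 * l) + Real.log (zetaSum l)
    - 1 / 2 * Real.log (1 - l) := rfl
  calc Real.exp (l * (S ^ 2 / (2 * N) - 2 * Real.log (4 + Real.log N)) - gFun l)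
      ≤ Real.exp ((-(2 * l) * Real.log ((m : ℝ) + 1) - Real.log (zetaSum l)) +
          ((1 / 2 * Real.log (1 - l) - 2 * l) + S ^ 2 / (2 * (N + c)))) := by
        apply Real.exp_le_exp.mpr
        rw [hg]
        nlinarith [mul_le_mul_of_nonneg_left hlogm h0.le]
    _ = ((m : ℝ) + 1) ^ (-(2 * l)) / zetaSum l *
        (Real.exp (1 / 2 * Real.log (1 - l) - 2 * l) * Real.exp (S ^ 2 / (2 * (N + c)))) := by
        rw [Real.exp_add, Real.exp_sub (-(2 * l) * _), Real.exp_log hz, ← hpow,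
          Real.exp_add (1 / 2 * Real.log (1 - l) - 2 * l)]
    _ ≤ _ := by gcongr

/-- All components are nonnegative, so one well-chosen component already bounds the mixture from
below. The prior itself does not depend on `N`. -/
lemma exp_le_lintegral_prior {l : ℝ} (hl : 1 / 2 < l) (hl' : l < 1) {N : ℝ} (hN : 1 ≤ N) (S : ℝ) :
    ENNReal.ofReal
        (Real.exp (l * (S ^ 2 / (2 * N) - 2 * Real.log (4 + Real.log N)) - gFun l)) ≤
      ∫⁻ x, ENNReal.ofReal (Real.exp (x * S - N * x ^ 2 / 2)) ∂(prior l) := by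
  have hz : 0 < zetaSum l := lt_of_lt_of_le one_pos (one_le_zetaSum hl)
  obtain ⟨m, hm⟩ := exp_le_component hl hl' hN S
  rw [prior, lintegral_sum_measure]
  refine le_trans ?_ (ENNReal.le_tsum m)
  rw [lintegral_smul_measure, lintegral_exp_gaussianReal (precision_pos hl hl' m) (by linarith),
    smul_eq_mul, ← ENNReal.ofReal_mul (by positivity)]
  exact ENNReal.ofReal_le_ofReal hm

/-! ### The threshold function -/

/-- Ensures that the `sInf` in `Cg` is a genuine infimum and not the default value 0. The bound is
crude. -/
lemma bddBelow_Cg (x : ℝ) (hx : 0 ≤ x) :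
    BddBelow ((fun l => (gFun l + x) / l) '' Set.Ioo (1 / 2) 1) := by
  refine ⟨-(4 * Real.log 4), ?_⟩
  rintro _ ⟨l, ⟨hl, hl'⟩, rfl⟩
  have h0 : 0 < l := by linarith
  have hz := Real.log_nonneg (one_le_zetaSum hl)
  have h1 : Real.log (1 - l) ≤ 0 := Real.log_nonpos (by linarith) (by linarith)
  have h2 : Real.log (4 * l) ≤ Real.log 4 := Real.log_le_log (by linarith) (by linarith)
  have h3 : 0 ≤ Real.log 4 := Real.log_nonneg (by norm_num)
  have hg : gFun l = 2 * l - 2 * l * Real.log (4 * l) + Real.log (zetaSum l)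
    - 1 / 2 * Real.log (1 - l) := rfl
  simp only
  rw [le_div_iff₀ h0, hg]
  nlinarith [mul_le_mul_of_nonneg_left h2 h0.le, mul_nonneg h0.le h3]

/-- **Ville's inequality** for a nonnegative extended-real supermartingale, with the supermartingale
property expressed through set integrals. -/
lemma ville_inequality {Ω : Type*} {mΩ : MeasurableSpace Ω} (P : Measure Ω)
    (ℱ : Filtration ℕ mΩ) (Z : ℕ → Ω → ENNReal) (hZ : ∀ t, Measurable[ℱ t] (Z t))
    (hstep : ∀ t G, MeasurableSet[ℱ t] G → ∫⁻ ω in G, Z (t + 1) ω ∂P ≤ ∫⁻ ω in G, Z t ω ∂P)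
    (h0 : ∫⁻ ω, Z 0 ω ∂P ≤ 1) (c : ENNReal) : c * P {ω | ∃ t, c ≤ Z t ω} ≤ 1 := by
  have hmono : Monotone fun t => {ω | ∃ s ≤ t, c ≤ Z s ω} :=
    fun a b hab ω ⟨s, hs, h⟩ => ⟨s, hs.trans hab, h⟩
  have hmeas : ∀ t, MeasurableSet[ℱ t] {ω | ∃ s ≤ t, c ≤ Z s ω} := by
    intro t
    have : {ω | ∃ s ≤ t, c ≤ Z s ω} = ⋃ s, ⋃ _ : s ≤ t, {ω | c ≤ Z s ω} := by
      ext ω; simp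
    rw [this]
    exact MeasurableSet.iUnion fun s => MeasurableSet.iUnion fun hs =>
      ℱ.mono hs _ (measurableSet_le measurable_const (hZ s))
  have hlevel : ∀ t (G : Set Ω), MeasurableSet G → (∀ ω ∈ G, c ≤ Z t ω) →
      c * P G ≤ ∫⁻ ω in G, Z t ω ∂P := by
    intro t G hG h
    rw [← setLIntegral_const]
    exact setLIntegral_mono' hG h
  -- Invariant replacing optional stopping: `c` times the mass that has crossed by time `t`, plus
  -- the integral of `Z t` over the rest. Newly crossing points have `Z (t + 1) ≥ c`, so moving them
  -- to the first term does not increase the total.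
  have hfin : ∀ t, c * P {ω | ∃ s ≤ t, c ≤ Z s ω} +
      ∫⁻ ω in {ω | ∃ s ≤ t, c ≤ Z s ω}ᶜ, Z t ω ∂P ≤ 1 := by
    intro t
    induction t with
    | zero =>
      have hm := ℱ.le 0 _ (hmeas 0)
      refine le_trans (le_trans ?_ (lintegral_add_compl (Z 0) hm).le) h0
      gcongr
      exact hlevel 0 _ hm fun ω ⟨s, hs, h⟩ => by rwa [Nat.le_zero.mp hs] at h
    | succ t ih =>
      set B := {ω | ∃ s ≤ t, c ≤ Z s ω}
      set B' := {ω | ∃ s ≤ t + 1, c ≤ Z s ω}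
      have hBB : B ⊆ B' := hmono (Nat.le_succ t)
      have hm := ℱ.le t _ (hmeas t)
      have hm' := ℱ.le (t + 1) _ (hmeas (t + 1))
      have hnew : ∀ ω ∈ B' \ B, c ≤ Z (t + 1) ω := by
        rintro ω ⟨⟨s, hs, h⟩, hn⟩
        rcases Nat.le_succ_iff.mp hs with h1 | h1
        · exact absurd ⟨s, h1, h⟩ hn
        · rwa [h1] at h
      have hsplit : Bᶜ = (B' \ B) ∪ B'ᶜ := by
        ext ω
        have := @hBB ω
        simp only [Set.mem_compl_iff, Set.mem_union, Set.mem_sdiff]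
        tauto
      have hdisj : Disjoint (B' \ B) B'ᶜ :=
        Set.disjoint_left.mpr fun ω h h' => h' h.1
      calc c * P B' + ∫⁻ ω in B'ᶜ, Z (t + 1) ω ∂P
          = c * P B + (c * P (B' \ B) + ∫⁻ ω in B'ᶜ, Z (t + 1) ω ∂P) := by
            rw [← add_assoc, ← mul_add, measure_add_sdiff hm.nullMeasurableSet B',
              Set.union_eq_self_of_subset_left hBB]
        _ ≤ c * P B + (∫⁻ ω in B' \ B, Z (t + 1) ω ∂P + ∫⁻ ω in B'ᶜ, Z (t + 1) ω ∂P) := by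
            gcongr
            exact hlevel (t + 1) _ (hm'.diff hm) hnew
        _ = c * P B + ∫⁻ ω in Bᶜ, Z (t + 1) ω ∂P := by
            rw [hsplit, lintegral_union hm'.compl hdisj]
        _ ≤ c * P B + ∫⁻ ω in Bᶜ, Z t ω ∂P := by
            exact add_le_add_right (hstep t _ (hmeas t).compl) _
        _ ≤ 1 := ih
  have hU : {ω | ∃ t, c ≤ Z t ω} = ⋃ t, {ω | ∃ s ≤ t, c ≤ Z s ω} := by
    ext ω
    simp only [Set.mem_ofPred_eq, Set.mem_iUnion]
    exact ⟨fun ⟨t, h⟩ => ⟨t, t, le_rfl, h⟩, fun ⟨_, s, _, h⟩ => ⟨s, h⟩⟩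
  rw [hU, hmono.measure_iUnion, ENNReal.mul_iSup]
  exact iSup_le fun t => le_self_add.trans (hfin t)

/-! ### The law of one round given the past -/

lemma measurable_histUpTo (t : ℕ) :
    Measurable fun ω : ℕ → Obs n k => histUpTo ω t :=
  measurable_pi_lambda _ fun _ => measurable_pi_apply _

instance law_isProbabilityMeasure (S : SamplingRule n k) (A : ContextMatrix n k)
    (μ : Fin k → ℝ) : IsProbabilityMeasure (law S A μ) := by
  unfold law
  infer_instance

lemma map_eval_zero_law (S : SamplingRule n k) (A : ContextMatrix n k) (μ : Fin k → ℝ) :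
    (law S A μ).map (fun ω => ω 0) = roundKernel S A μ 0 Fin.elim0 := by
  have h : (law S A μ).map (Preorder.frestrictLe (π := fun _ => Obs n k) 0) =
      (roundKernel S A μ 0 Fin.elim0).map
        (MeasurableEquiv.piUnique fun _ : Finset.Iic 0 => Obs n k).symm := by
    unfold law Kernel.trajMeasure
    rw [Measure.map_comp _ _ (by fun_prop), Kernel.traj_map_frestrictLe, Kernel.partialTraj_self,
      Measure.id_comp]
  have h2 : (fun ω : ℕ → Obs n k => ω 0) =
      (fun x : Finset.Iic 0 → Obs n k => x default) ∘
        Preorder.frestrictLe (π := fun _ => Obs n k) 0 := rfl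
  rw [h2, ← Measure.map_map (by fun_prop) (by fun_prop), h, Measure.map_map (by fun_prop)
    (by fun_prop)]
  exact Measure.map_id

/-- Disintegration of the trajectory law at round `t`. Round 0 is separate because it enters `law`
as the initial measure, not through a transition kernel. -/
lemma lintegral_law_step (S : SamplingRule n k) (A : ContextMatrix n k) (μ : Fin k → ℝ) (t : ℕ)
    (f : Hist n k t → Obs n k → ENNReal) (hf : Measurable (Function.uncurry f)) :
    ∫⁻ ω, f (histUpTo ω t) (ω t) ∂(law S A μ) =
      ∫⁻ ω, ∫⁻ x, f (histUpTo ω t) x ∂(roundKernel S A μ t (histUpTo ω t)) ∂(law S A μ) := by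
  cases t with
  | zero =>
    have h0 : ∀ ω : ℕ → Obs n k, histUpTo ω 0 = Fin.elim0 := fun ω => Subsingleton.elim _ _
    simp_rw [h0]
    have hf0 : Measurable (f Fin.elim0) := hf.comp measurable_prodMk_left
    rw [lintegral_const, measure_univ, mul_one, ← map_eval_zero_law,
      lintegral_map hf0 (by fun_prop)]
  | succ t =>
    have hkey := Kernel.map_frestrictLe_trajMeasure_compProd_eq_map_trajMeasure
      (X := fun _ => Obs n k) (μ₀ := roundKernel S A μ 0 Fin.elim0)
      (κ := fun t => (roundKernel S A μ (t + 1)).comap (toHist t) (measurable_toHist t)) (a := t)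
    change (law S A μ).map _ ⊗ₘ _ = (law S A μ).map _ at hkey
    have hF : Measurable fun p : (Finset.Iic t → Obs n k) × Obs n k => f (toHist t p.1) p.2 :=
      hf.comp (((measurable_toHist t).comp measurable_fst).prodMk measurable_snd)
    have h1 : ∫⁻ ω, f (histUpTo ω (t + 1)) (ω (t + 1)) ∂(law S A μ) =
        ∫⁻ p, f (toHist t p.1) p.2 ∂((law S A μ).map
          fun x => (Preorder.frestrictLe (π := fun _ => Obs n k) t x, x (t + 1))) := by
      rw [lintegral_map hF (by fun_prop)]
      rfl
    rw [h1, ← hkey, Measure.lintegral_compProd hF, lintegral_map _ (by fun_prop)]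
    · rfl
    · exact Measurable.lintegral_kernel_prod_right hF

/-! ### Likelihood ratios -/

/-- The logarithm of the likelihood ratio of one observation when the mean vector is shifted
by `η`. -/
def logRatio (μ η : Fin k → ℝ) (o : Obs n k) : ℝ :=
  ∑ j, if o.2.1 = j then η j * (o.2.2 - μ j) - η j ^ 2 / 2 else 0

lemma measurable_logRatio (μ : Fin k → ℝ) :
    Measurable fun p : (Fin k → ℝ) × Obs n k => logRatio μ p.1 p.2 := by
  unfold logRatio
  refine Finset.measurable_fun_sum _ fun j _ => Measurable.ite ?_ (by fun_prop) measurable_const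
  exact measurableSet_eq_fun (by fun_prop) measurable_const

lemma measurable_exp_logRatio (μ η : Fin k → ℝ) :
    Measurable fun o : Obs n k => ENNReal.ofReal (Real.exp (logRatio μ η o)) :=
  (Real.measurable_exp.comp ((measurable_logRatio μ).comp measurable_prodMk_left)).ennreal_ofReal

/-- Given context `j`, the ratio turns the density of `N(μ_j, 1)` into that of `N(μ_j + η_j, 1)`, so
each context contributes its full probability, whatever the arm. -/
lemma lintegral_exp_logRatio_armLaw (A : ContextMatrix n k) (μ η : Fin k → ℝ) (i : Fin n) :
    ∫⁻ x, ENNReal.ofReal (Real.exp (logRatio μ η (i, x))) ∂(armLaw A μ i) = 1 := by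
  have hm : Measurable fun x : Fin k × ℝ => ENNReal.ofReal (Real.exp (logRatio μ η (i, x))) :=
    (measurable_exp_logRatio μ η).comp measurable_prodMk_left
  have hj : ∀ j, ∫⁻ x, ENNReal.ofReal (Real.exp (logRatio μ η (i, x)))
      ∂((Measure.dirac j).prod (gaussianReal (μ j) 1)) = 1 := by
    intro j
    rw [lintegral_prod _ hm.aemeasurable, lintegral_dirac]
    simp only [logRatio, Finset.sum_ite_eq, Finset.mem_univ, if_true]
    rw [gaussianReal_of_var_ne_zero _ one_ne_zero,
      lintegral_withDensity_eq_lintegral_mul _ (measurable_gaussianPDF _ _) (by fun_prop)]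
    rw [← lintegral_gaussianPDF_eq_one (μ j + η j) (one_ne_zero (α := NNReal))]
    refine lintegral_congr fun y => ?_
    simp only [Pi.mul_apply, gaussianPDF]
    rw [← ENNReal.ofReal_mul (gaussianPDFReal_nonneg _ _ _)]
    simp only [gaussianPDFReal]
    rw [mul_assoc, ← Real.exp_add]
    congr 3
    simp only [NNReal.coe_one]
    ring
  unfold armLaw
  rw [lintegral_finsetSum_measure]
  simp only [lintegral_smul_measure, hj, smul_eq_mul, mul_one]
  rw [← ENNReal.ofReal_sum_of_nonneg (fun j _ => A.nonneg j i), A.sum_col i, ENNReal.ofReal_one]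

lemma lintegral_exp_logRatio_roundKernel (S : SamplingRule n k) (A : ContextMatrix n k)
    (μ η : Fin k → ℝ) (t : ℕ) (h : Hist n k t) :
    ∫⁻ x, ENNReal.ofReal (Real.exp (logRatio μ η x)) ∂(roundKernel S A μ t h) = 1 := by
  have := S.markov t
  have hm := measurable_exp_logRatio (n := n) μ η
  unfold roundKernel
  rw [Kernel.lintegral_compProd _ _ _ hm]
  have : ∀ i, ∫⁻ x, ENNReal.ofReal (Real.exp (logRatio μ η (i, x)))
      ∂(Kernel.prodMkLeft (Hist n k t) (envKernel A μ) (h, i)) = 1 :=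
    fun i => lintegral_exp_logRatio_armLaw A μ η i
  simp only [this, lintegral_one, measure_univ]

/-- The likelihood ratio of a history when the mean vector is shifted by `η`. -/
def likelihoodRatio (μ η : Fin k → ℝ) {t : ℕ} (h : Hist n k t) : ENNReal :=
  ENNReal.ofReal (Real.exp (∑ s, logRatio μ η (h s)))

lemma measurable_likelihoodRatio (μ : Fin k → ℝ) (t : ℕ) :
    Measurable fun p : (Fin k → ℝ) × Hist n k t => likelihoodRatio μ p.1 p.2 := by
  unfold likelihoodRatio
  refine (Real.measurable_exp.comp (Finset.measurable_fun_sum _ fun s _ => ?_)).ennreal_ofReal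
  exact (measurable_logRatio μ).comp
    (measurable_fst.prodMk ((measurable_pi_apply s).comp measurable_snd))

lemma likelihoodRatio_succ (μ η : Fin k → ℝ) (ω : ℕ → Obs n k) (t : ℕ) :
    likelihoodRatio μ η (histUpTo ω (t + 1)) =
      likelihoodRatio μ η (histUpTo ω t) * ENNReal.ofReal (Real.exp (logRatio μ η (ω t))) := by
  unfold likelihoodRatio
  rw [← ENNReal.ofReal_mul (Real.exp_pos _).le, ← Real.exp_add, Fin.sum_univ_castSucc]
  rfl

/-- The martingale property, tested on events of the first `t` rounds: the new factor has
conditional mean 1. -/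
lemma setLIntegral_likelihoodRatio_succ (S : SamplingRule n k) (A : ContextMatrix n k)
    (μ η : Fin k → ℝ) (t : ℕ) (B : Set (Hist n k t)) (hB : MeasurableSet B) :
    ∫⁻ ω in (histUpTo · t) ⁻¹' B, likelihoodRatio μ η (histUpTo ω (t + 1)) ∂(law S A μ) =
      ∫⁻ ω in (histUpTo · t) ⁻¹' B, likelihoodRatio μ η (histUpTo ω t) ∂(law S A μ) := by
  have hL : Measurable fun h : Hist n k t => likelihoodRatio μ η h :=
    Measurable.comp (g := fun p : (Fin k → ℝ) × Hist n k t => likelihoodRatio μ p.1 p.2)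
      (f := fun h => (η, h)) (measurable_likelihoodRatio μ t) measurable_prodMk_left
  have hm := measurable_exp_logRatio (n := n) μ η
  have hB' := measurable_histUpTo t hB
  rw [← lintegral_indicator hB', ← lintegral_indicator hB']
  have h1 : ∀ ω, ((histUpTo · t) ⁻¹' B).indicator
      (fun ω => likelihoodRatio μ η (histUpTo ω (t + 1))) ω =
      B.indicator (fun h => likelihoodRatio μ η h) (histUpTo ω t) *
        ENNReal.ofReal (Real.exp (logRatio μ η (ω t))) := by
    intro ω
    by_cases h : histUpTo ω t ∈ B
    · rw [Set.indicator_of_mem (by exact h), Set.indicator_of_mem h, likelihoodRatio_succ]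
    · rw [Set.indicator_of_notMem (by exact h), Set.indicator_of_notMem h, zero_mul]
  simp_rw [h1]
  rw [lintegral_law_step S A μ t (fun h x => B.indicator (fun h => likelihoodRatio μ η h) h *
        ENNReal.ofReal (Real.exp (logRatio μ η x)))
      (((hL.indicator hB).comp measurable_fst).mul (hm.comp measurable_snd))]
  refine lintegral_congr fun ω => ?_
  rw [lintegral_const_mul _ hm, lintegral_exp_logRatio_roundKernel, mul_one]
  rfl

/-- The filtration generated by the observations. -/
def obsFiltration (n k : ℕ) : Filtration ℕ (inferInstance : MeasurableSpace (ℕ → Obs n k)) where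
  seq t := MeasurableSpace.comap (histUpTo · t) inferInstance
  mono' s t hst := by
    have : (fun ω : ℕ → Obs n k => histUpTo ω s) =
        (fun (h : Hist n k t) (r : Fin s) => h (Fin.castLE hst r)) ∘ (histUpTo · t) := rfl
    change MeasurableSpace.comap (fun ω : ℕ → Obs n k => histUpTo ω s) _ ≤ _
    rw [this, ← MeasurableSpace.comap_comp]
    exact MeasurableSpace.comap_mono (Measurable.comap_le
      (measurable_pi_lambda _ fun _ => measurable_pi_apply _))
  le' t := (measurable_histUpTo t).comap_le

/-- The mixture of likelihood ratios over shifts with law `Q`. -/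
def mixtureRatio (Q : Measure (Fin k → ℝ)) (μ : Fin k → ℝ) {t : ℕ} (h : Hist n k t) : ENNReal :=
  ∫⁻ η, likelihoodRatio μ η h ∂Q

lemma measurable_mixtureRatio (Q : Measure (Fin k → ℝ)) [IsProbabilityMeasure Q] (μ : Fin k → ℝ)
    (t : ℕ) : Measurable fun h : Hist n k t => mixtureRatio Q μ h :=
  (measurable_likelihoodRatio μ t).lintegral_prod_left'

/-- Tonelli transfers the martingale property from each `η` to the mixture, which equals 1 on the
empty history; Ville's inequality then applies. -/
lemma mul_law_mixtureRatio_le (S : SamplingRule n k) (A : ContextMatrix n k)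
    (Q : Measure (Fin k → ℝ)) [IsProbabilityMeasure Q] (μ : Fin k → ℝ) (c : ENNReal) :
    c * law S A μ {ω | ∃ t, c ≤ mixtureRatio Q μ (histUpTo ω t)} ≤ 1 := by
  have hswap : ∀ t t' (B : Set (Hist n k t)),
      ∫⁻ ω in (histUpTo · t) ⁻¹' B, mixtureRatio Q μ (histUpTo ω t') ∂(law S A μ) =
      ∫⁻ η, ∫⁻ ω in (histUpTo · t) ⁻¹' B, likelihoodRatio μ η (histUpTo ω t') ∂(law S A μ) ∂Q := by
    intro t t' B
    unfold mixtureRatio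
    refine lintegral_lintegral_swap (Measurable.aemeasurable ?_)
    exact Measurable.comp (g := fun p : (Fin k → ℝ) × Hist n k t' => likelihoodRatio μ p.1 p.2)
      (f := fun q : (ℕ → Obs n k) × (Fin k → ℝ) => (q.2, histUpTo q.1 t'))
      (measurable_likelihoodRatio μ t')
      (measurable_snd.prodMk ((measurable_histUpTo t').comp measurable_fst))
  refine ville_inequality (law S A μ) (obsFiltration n k)
    (fun t ω => mixtureRatio Q μ (histUpTo ω t)) (fun t => ?_) ?_ ?_ c
  · exact (measurable_mixtureRatio Q μ t).comp (comap_measurable _)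
  · rintro t _ ⟨B, hB, rfl⟩
    rw [hswap t (t + 1) B, hswap t t B]
    exact (lintegral_congr fun η => setLIntegral_likelihoodRatio_succ S A μ η t B hB).le
  · simp [mixtureRatio, likelihoodRatio]

/-! ### Lower bound for the mixture -/

lemma sum_logRatio (μ η : Fin k → ℝ) {t : ℕ} (h : Hist n k t) (hc : ∀ j, 0 < contextCount h j) :
    ∑ s, logRatio μ η (h s) =
      ∑ j, (η j * (contextCount h j * (empMean h j - μ j)) - contextCount h j * η j ^ 2 / 2) := by
  unfold logRatio
  rw [Finset.sum_comm]
  refine Finset.sum_congr rfl fun j _ => ?_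
  have hN : (contextCount h j : ℝ) ≠ 0 := by exact_mod_cast (hc j).ne'
  rw [← Finset.sum_filter, Finset.sum_sub_distrib, ← Finset.mul_sum, Finset.sum_sub_distrib,
    Finset.sum_const, Finset.sum_const, nsmul_eq_mul, nsmul_eq_mul]
  have : (contextCount h j : ℝ) * empMean h j =
      ∑ s ∈ Finset.univ.filter (fun s => (h s).2.1 = j), (h s).2.2 := by
    rw [empMean]; field_simp
  rw [mul_sub (contextCount h j : ℝ), this]
  simp only [contextCount]
  ring

/-- The log-likelihood separates over contexts and the prior is a product, so the mixture is a
product of one-dimensional integrals, each bounded with `N = N_j` and `S = N_j (μ̂_j - μ_j)`. -/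
lemma le_mixtureRatio {l : ℝ} (hl : 1 / 2 < l) (hl' : l < 1) (μ : Fin k → ℝ) {t : ℕ}
    (h : Hist n k t) (hc : ∀ j, 0 < contextCount h j) :
    ENNReal.ofReal (Real.exp (l * (∑ j, contextCount h j * ((empMean h j - μ j) ^ 2 / 2) -
        2 * ∑ j, Real.log (4 + Real.log (contextCount h j))) - k * gFun l)) ≤
      mixtureRatio (Measure.pi fun _ => prior l) μ h := by
  have := isProbabilityMeasure_prior hl
  set X : Fin k → ℝ → ENNReal := fun j x => ENNReal.ofReal (Real.exp
    (x * (contextCount h j * (empMean h j - μ j)) - contextCount h j * x ^ 2 / 2)) with hX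
  have hXm : ∀ j, Measurable (X j) := fun j => by fun_prop
  have hprod : mixtureRatio (Measure.pi fun _ => prior l) μ h = ∏ j, ∫⁻ x, X j x ∂(prior l) := by
    have hind := iIndepFun_pi (μ := fun _ : Fin k => prior l) (X := X)
      fun j => (hXm j).aemeasurable
    have h1 := lintegral_prod_eq_prod_lintegral_of_indepFun Finset.univ _ hind
      fun j => (hXm j).comp (measurable_pi_apply j)
    unfold mixtureRatio likelihoodRatio
    simp_rw [sum_logRatio μ _ h hc, Real.exp_sum]
    simp_rw [ENNReal.ofReal_prod_of_nonneg fun _ _ => (Real.exp_pos _).le]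
    rw [h1]
    refine Finset.prod_congr rfl fun j _ => ?_
    exact (measurePreserving_eval (fun _ : Fin k => prior l) j).lintegral_comp (hXm j)
  rw [hprod]
  have hexp : l * (∑ j, contextCount h j * ((empMean h j - μ j) ^ 2 / 2) -
        2 * ∑ j, Real.log (4 + Real.log (contextCount h j))) - k * gFun l =
      ∑ j, (l * ((contextCount h j * (empMean h j - μ j)) ^ 2 / (2 * contextCount h j) -
        2 * Real.log (4 + Real.log (contextCount h j))) - gFun l) := by
    rw [Finset.sum_sub_distrib, ← Finset.mul_sum, Finset.sum_sub_distrib, ← Finset.mul_sum]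
    simp only [Finset.sum_const, Finset.card_univ, Fintype.card_fin, nsmul_eq_mul]
    congr 3
    refine Finset.sum_congr rfl fun j _ => ?_
    have hN : (contextCount h j : ℝ) ≠ 0 := by exact_mod_cast (hc j).ne'
    field_simp
  rw [hexp, Real.exp_sum, ENNReal.ofReal_prod_of_nonneg fun _ _ => (Real.exp_pos _).le]
  refine Finset.prod_le_prod' fun j _ => ?_
  exact exp_le_lintegral_prior hl hl' (by exact_mod_cast hc j) _

/-! ### Uniform deviations -/

/-- The histories at which the deviation of the empirical means exceeds the logarithmic terms
plus `b`. -/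
def deviationEvent (μ : Fin k → ℝ) (b : ℝ) : Set (ℕ → Obs n k) :=
  {ω | ∃ t, (∀ j, 0 < contextCount (histUpTo ω t) j) ∧
    2 * ∑ j, Real.log (4 + Real.log (contextCount (histUpTo ω t) j)) + b <
      ∑ j, contextCount (histUpTo ω t) j * ((empMean (histUpTo ω t) j - μ j) ^ 2 / 2)}

lemma law_deviationEvent_le {δ : ℝ} (hδ₀ : 0 < δ) (hk : k ≠ 0) (S : SamplingRule n k)
    (A : ContextMatrix n k) (μ : Fin k → ℝ) {l : ℝ} (hl : 1 / 2 < l) (hl' : l < 1) :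
    law S A μ (deviationEvent μ (k * ((gFun l + Real.log (1 / δ) / k) / l))) ≤
      ENNReal.ofReal δ := by
  have := isProbabilityMeasure_prior hl
  have h0 : 0 < l := by linarith
  have hk' : (k : ℝ) ≠ 0 := by exact_mod_cast hk
  have hville := mul_law_mixtureRatio_le S A (Measure.pi fun _ => prior l) μ
    (ENNReal.ofReal (1 / δ))
  have hsub : (deviationEvent μ (k * ((gFun l + Real.log (1 / δ) / k) / l)) : Set (ℕ → Obs n k)) ⊆
      {ω | ∃ t, ENNReal.ofReal (1 / δ) ≤
        mixtureRatio (Measure.pi fun _ => prior l) μ (histUpTo ω t)} := by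
    rintro ω ⟨t, hc, hlt⟩
    refine ⟨t, le_trans (ENNReal.ofReal_le_ofReal ?_) (le_mixtureRatio hl hl' μ _ hc)⟩
    rw [← Real.log_le_iff_le_exp (by positivity)]
    -- The level is chosen so that, after multiplying by `l` and subtracting `k * gFun l`, exactly
    -- `log (1 / δ)` remains.
    have h1 : l * (k * ((gFun l + Real.log (1 / δ) / k) / l)) =
        k * gFun l + Real.log (1 / δ) := by field_simp
    nlinarith [mul_lt_mul_of_pos_left hlt h0]
  have h2 := (mul_le_mul_right (measure_mono hsub) (ENNReal.ofReal (1 / δ))).trans hville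
  rw [one_div, ENNReal.ofReal_inv_of_pos hδ₀, mul_comm, ← div_eq_mul_inv,
    ENNReal.div_le_iff (by simpa using hδ₀) ENNReal.ofReal_ne_top, one_mul, ← one_div] at h2
  exact h2

/-- The infimum need not be known to be attained: along a minimising decreasing sequence of levels
the events increase, and their union covers the limiting event because its inequality is strict.
Continuity from below keeps the bound `δ`. -/
lemma law_deviationEvent_Cg_le {δ : ℝ} (hδ₀ : 0 < δ) (hδ₁ : δ < 1) (hk : k ≠ 0)
    (S : SamplingRule n k) (A : ContextMatrix n k) (μ : Fin k → ℝ) :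
    law S A μ (deviationEvent μ (k * Cg (Real.log (1 / δ) / k))) ≤ ENNReal.ofReal δ := by
  have hk' : (0 : ℝ) < k := by exact_mod_cast Nat.pos_of_ne_zero hk
  have hx : 0 ≤ Real.log (1 / δ) / k :=
    div_nonneg (Real.log_nonneg (by rw [le_div_iff₀ hδ₀]; linarith)) hk'.le
  obtain ⟨u, hanti, hlim, hu⟩ := exists_seq_tendsto_sInf
    (S := (fun l => (gFun l + Real.log (1 / δ) / k) / l) '' Set.Ioo (1 / 2) 1)
    ((Set.nonempty_Ioo.mpr (by norm_num)).image _) (bddBelow_Cg _ hx)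
  have hmono : Monotone fun m => (deviationEvent μ (k * u m) : Set (ℕ → Obs n k)) := by
    rintro a b hab ω ⟨t, hc, hlt⟩
    exact ⟨t, hc, by nlinarith [mul_le_mul_of_nonneg_left (hanti hab) hk'.le]⟩
  have hsub : (deviationEvent μ (k * Cg (Real.log (1 / δ) / k)) : Set (ℕ → Obs n k)) ⊆
      ⋃ m, deviationEvent μ (k * u m) := by
    rintro ω ⟨t, hc, hlt⟩
    have h1 := ((hlim.const_mul (k : ℝ)).const_add
      (2 * ∑ j, Real.log (4 + Real.log (contextCount (histUpTo ω t) j)))).eventually_lt_const hlt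
    obtain ⟨m, hm⟩ := h1.exists
    exact Set.mem_iUnion.mpr ⟨m, t, hc, hm⟩
  refine (measure_mono hsub).trans ?_
  rw [hmono.measure_iUnion]
  refine iSup_le fun m => ?_
  obtain ⟨l, ⟨hl, hl'⟩, hlu⟩ := hu m
  rw [← hlu]
  exact law_deviationEvent_le hδ₀ hk S A μ hl hl'

/-! ### The stopping rule -/

lemma glrStatistic_le {A : ContextMatrix n k} {μ : Fin k → ℝ} (hμ : μ ∈ uniqueBestSet A) {t : ℕ}
    (h : Hist n k t) (hne : bestArm A (empMean h) ≠ bestArm A μ) :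
    glrStatistic A h ≤
      ((∑ j, (contextCount h j : ℝ) * ((empMean h j - μ j) ^ 2 / 2) : ℝ) : EReal) := by
  unfold glrStatistic
  split_ifs with he
  · exact iInf₂_le μ ⟨hμ, hne.symm⟩
  -- Without a unique empirical best arm the statistic is 0, so the bound is trivial.
  · exact EReal.coe_nonneg.mpr (Finset.sum_nonneg fun j _ => by positivity)

lemma stops_of_stoppingTime_lt_top (alg : Algorithm n k) (ω : ℕ → Obs n k)
    (h : alg.stoppingTime ω < ⊤) : alg.stops (histUpTo ω (alg.stoppingTime ω).toNat) := by
  classical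
  have hex : ∃ t : ℕ, alg.stops (histUpTo ω t) := by
    by_contra hcon
    push Not at hcon
    simp [Algorithm.stoppingTime, hcon] at h
  have heq : alg.stoppingTime ω = (Nat.find hex : ℕ∞) := by
    refine le_antisymm (iInf₂_le (Nat.find hex) (Nat.find_spec hex)) (le_iInf₂ fun t ht => ?_)
    exact_mod_cast Nat.find_min' hex ht
  rw [heq, ENat.toNat_natCast]
  exact Nat.find_spec hex

end PostActionBAI

end

theorem mainTheorem6 {n k : ℕ} (δ : ℝ) (hδ₀ : 0 < δ) (hδ₁ : δ < 1)
    (S : PostActionBAI.ContextMatrix n k → PostActionBAI.SamplingRule n k) :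
    PostActionBAI.IsDeltaCorrect δ
      (fun A => PostActionBAI.glrAlgorithm δ (S A) A) := by
  intro A μ hμ
  -- A best arm exists, and with no contexts its column would sum to 0 instead of 1.
  have hk : k ≠ 0 := by
    rintro rfl
    obtain ⟨i, -⟩ := hμ
    simpa using A.sum_col i
  refine (measure_mono ?_).trans
    (PostActionBAI.law_deviationEvent_Cg_le hδ₀ hδ₁ hk (S A) A μ)
  rintro ω ⟨hτ, hrec⟩
  obtain ⟨hc, hlt⟩ := PostActionBAI.stops_of_stoppingTime_lt_top _ ω hτ
  refine ⟨_, hc, ?_⟩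
  exact EReal.coe_lt_coe_iff.mp (hlt.trans_le (PostActionBAI.glrStatistic_le hμ _ hrec))
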